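/- Let $d$ be a squarefree integer and let $H^d$ be the smooth projective genus one curve over $\mathbb{Q}$ with affine equation $dy^2=(x^2-x-3)(x^2+2x-12)$, that is, the curve $dy^2=(x^2-xz-3z^2)(x^2+2xz-12z^2)$ in the weighted projective plane with weights $(1,2,1)$ for $(x,y,z)$. Then $H^d$ is everywhere locally solvable, i.e. $H^d(\mathbb{R})\neq\emptyset$ and $H^d(\mathbb{Q}_p)\neq\emptyset$ for all primes $p$, if and only if every prime $p$ dividing $d$ satisfies $\left(\frac{p}{13}\right)=1$ or $p=13$. -/

import Mathlib

instance fact_prime_thirteen : Fact (Nat.Prime 13) := ⟨by norm_num⟩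

namespace TwistedQuartic

/-- The binary quartic form `F(x, z)`, the homogenization of `(x² - x - 3)(x² + 2x - 12)`. -/
def form {K : Type*} [Field K] (x z : K) : K :=
  (x ^ 2 - x * z - 3 * z ^ 2) * (x ^ 2 + 2 * x * z - 12 * z ^ 2)

/-- `H^d(K) ≠ ∅`, where `H^d : d y² = (x² - x - 3)(x² + 2x - 12)` is the smooth projective genus
one curve `d y² = F(x, z)` in the weighted projective plane with weights `(1, 2, 1)` for
`(x, y, z)`. The points with `z ≠ 0` are those of the affine equation; the points with `z = 0`
are the two points at infinity, which are defined over `K` iff `d` is a square in `K`. (The case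
`x = z = 0` would force `y = 0`, so excluding it excludes exactly the zero vector, for `d ≠ 0`
in `K`.) -/
def HasPoint (d : ℤ) (K : Type*) [Field K] : Prop :=
  ∃ x y z : K, (x ≠ 0 ∨ z ≠ 0) ∧ (d : K) * y ^ 2 = form x z

/-- For `d ≠ 0` in `K`, a point is a point of the affine equation or one of the two points at
infinity. -/
theorem hasPoint_iff {K : Type*} [Field K] {d : ℤ} (hd : (d : K) ≠ 0) :
    HasPoint d K ↔
      (∃ x y : K, (d : K) * y ^ 2 = (x ^ 2 - x - 3) * (x ^ 2 + 2 * x - 12)) ∨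
        IsSquare (d : K) := by
  constructor
  · rintro ⟨x, y, z, h, e⟩
    by_cases hz : z = 0
    · subst hz
      have hx : x ≠ 0 := by simpa using h
      have e' : (d : K) * y ^ 2 = x ^ 4 := by rw [e, form]; ring
      have hy : y ≠ 0 := by
        rintro rfl
        exact pow_ne_zero 4 hx (by rw [← e']; ring)
      refine Or.inr ⟨x ^ 2 / y, ?_⟩
      field_simp
      rw [e']
    · refine Or.inl ⟨x / z, y / z ^ 2, ?_⟩
      unfold form at e
      field_simp
      linear_combination e
  · rintro (⟨x, y, e⟩ | ⟨r, hr⟩)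
    · exact ⟨x, y, 1, Or.inr one_ne_zero, by rw [e, form]; ring⟩
    · have h0 : r ≠ 0 := by
        rintro rfl
        exact hd (by simpa using hr)
      refine ⟨1, r⁻¹, 0, Or.inl one_ne_zero, ?_⟩
      rw [hr, form]
      field_simp
      ring

/-- `H^d` has points over every completion of `ℚ`, that is, over `ℝ` and over all `ℚ_p`. -/
def EverywhereLocallySolvable (d : ℤ) : Prop :=
  HasPoint d ℝ ∧ ∀ (p : ℕ) [Fact p.Prime], HasPoint d ℚ_[p]

end TwistedQuartic

namespace TwistedQuartic

section Field

variable {K : Type*} [Field K] {d : ℤ}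

/-! Both quadratic factors are norm forms from `ℚ(√13)`: with `N(u, w) = u² - uw - 3w²`, the quartic
is `N(x, z) · N(x + 2z, 2z)`. At a prime `p` inert in `ℚ(√13)`, nonzero values of `N` have even
valuation, whereas `d y²` has odd valuation if `p` exactly divides `d`
(`not_hasPoint_of_anisotropic`). Conversely, a point exists once `d` times some value of the quartic
is a square. The values 1, 13, 27 and -36 at small integers, together with a root when 13 is a
square, suffice over every completion. -/

theorem hasPoint_of_isSquare_mul (hd : (d : K) ≠ 0) (x z : K) (hxz : x ≠ 0 ∨ z ≠ 0)
    (h : IsSquare ((d : K) * form x z)) : HasPoint d K := by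
  obtain ⟨r, hr⟩ := h
  refine ⟨x, r / d, z, hxz, ?_⟩
  field_simp
  linear_combination -hr

theorem hasPoint_of_isSquare (hd : (d : K) ≠ 0) (h : IsSquare (d : K)) : HasPoint d K :=
  (hasPoint_iff hd).2 (Or.inr h)

theorem hasPoint_of_isSquare_mul_thirteen (hd : (d : K) ≠ 0)
    (h : IsSquare ((d * 13 : ℤ) : K)) : HasPoint d K := by
  refine hasPoint_of_isSquare_mul hd (-1) 1 (Or.inr one_ne_zero) ?_
  have : (d : K) * form (-1) 1 = ((d * 13 : ℤ) : K) := by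
    simp only [form]; push_cast; ring
  rwa [this]

/-- If `13` is a square, then the quartic form has a root, giving a point with `y = 0`. -/
theorem hasPoint_of_isSquare_thirteen (h : IsSquare ((13 : ℤ) : K)) : HasPoint d K := by
  obtain ⟨r, hr⟩ := h
  push_cast at hr
  -- The second factor is `(x + 1)² - 13`.
  refine ⟨-1 + r, 0, 1, Or.inr one_ne_zero, ?_⟩
  simp only [form]
  linear_combination ((-1 + r) ^ 2 - (-1 + r) * 1 - 3 * 1 ^ 2) * hr

end Field

theorem hasPoint_real {d : ℤ} (hd : d ≠ 0) : HasPoint d ℝ := by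
  have hd' : (d : ℝ) ≠ 0 := by exact_mod_cast hd
  rcases lt_or_gt_of_ne hd' with h | h
  -- The quartic takes the negative value -36 here.
  · refine hasPoint_of_isSquare_mul hd' (-2) 1 (Or.inr one_ne_zero) ?_
    refine ⟨√((d : ℝ) * form (-2) 1), (Real.mul_self_sqrt ?_).symm⟩
    norm_num [form]
    linarith
  · exact hasPoint_of_isSquare hd' ⟨√(d : ℝ), (Real.mul_self_sqrt h.le).symm⟩

/-! ### Squares and norm-form values in `ℚ_p`. -/

section Padic

variable {p : ℕ} [hp : Fact p.Prime]

theorem padic_isSquare_of_norm_lt (n a : ℤ)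
    (h : ‖((a ^ 2 - n : ℤ) : ℤ_[p])‖ < ‖((2 * a : ℤ) : ℤ_[p])‖ ^ 2) :
    IsSquare (n : ℚ_[p]) := by
  obtain ⟨z, hz, -⟩ := hensels_lemma (p := p) (R := ℤ_[p])
    (F := Polynomial.X ^ 2 - Polynomial.C (n : ℤ_[p])) (a := (a : ℤ_[p]))
    (by simpa [one_add_one_eq_two] using h)
  have hz' : z ^ 2 = (n : ℤ_[p]) := by
    simpa [sub_eq_zero] using hz
  refine ⟨(z : ℚ_[p]), ?_⟩
  have := congrArg (fun t : ℤ_[p] => (t : ℚ_[p])) hz'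
  push_cast at this
  rw [← this, sq]

theorem padic_isSquare_of_isSquare_zmod (hp2 : p ≠ 2) (n : ℤ) (hn : (n : ZMod p) ≠ 0)
    (h : IsSquare (n : ZMod p)) : IsSquare (n : ℚ_[p]) := by
  obtain ⟨r, hr⟩ := h
  obtain ⟨a, rfl⟩ := ZMod.intCast_surjective r
  refine padic_isSquare_of_norm_lt n a ?_
  have h1 : ‖((2 * a : ℤ) : ℤ_[p])‖ = 1 := by
    refine le_antisymm (PadicInt.norm_le_one _) (not_lt.1 fun hlt => ?_)
    rw [PadicInt.norm_int_lt_one_iff_dvd] at hlt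
    rcases (Nat.prime_iff_prime_int.1 hp.out).dvd_or_dvd hlt with h2 | h2
    · have h2 : p ∣ 2 := by exact_mod_cast h2
      exact hp2 ((Nat.prime_dvd_prime_iff_eq hp.out Nat.prime_two).1 h2)
    · rw [← ZMod.intCast_zmod_eq_zero_iff_dvd] at h2
      exact hn (by rw [hr, h2, mul_zero])
  rw [h1, one_pow, PadicInt.norm_int_lt_one_iff_dvd, ← ZMod.intCast_zmod_eq_zero_iff_dvd]
  push_cast
  rw [hr]
  ring

theorem two_adic_isSquare_of_mod_eight (n : ℤ) (h : n % 8 = 1) : IsSquare (n : ℚ_[2]) := by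
  refine padic_isSquare_of_norm_lt n 1 ?_
  have h1 : ‖((1 ^ 2 - n : ℤ) : ℤ_[2])‖ ≤ (2 : ℝ) ^ (-(3 : ℕ) : ℤ) := by
    have := (PadicInt.norm_int_le_pow_iff_dvd (p := 2) (k := 1 ^ 2 - n) (n := 3)).2
      (by push_cast; omega)
    exact_mod_cast this
  have h2 : ‖((2 * 1 : ℤ) : ℤ_[2])‖ = 2⁻¹ := by
    have := PadicInt.norm_p (p := 2)
    simpa using this
  rw [h2]
  refine lt_of_le_of_lt h1 ?_
  norm_num

/-- When the norm form `u² - uw - 3w²` is anisotropic modulo `p`, its nonzero values have even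
valuation. -/
theorem even_valuation_normForm (hirr : ∀ t : ZMod p, t ^ 2 - t - 3 ≠ 0) (u w : ℚ_[p])
    (huw : u ≠ 0 ∨ w ≠ 0) :
    u ^ 2 - u * w - 3 * w ^ 2 ≠ 0 ∧ Even (u ^ 2 - u * w - 3 * w ^ 2).valuation := by
  have h3 : ((3 : ℤ_[p]) : ℚ_[p]) = 3 := rfl
  -- Factoring out the square of the larger coordinate leaves a unit: its residue is a value of `t²
  -- - t - 3`, or 1 when `w / u` reduces to 0.
  have key : ∃ c s : ℚ_[p], c ≠ 0 ∧ ‖s‖ = 1 ∧ u ^ 2 - u * w - 3 * w ^ 2 = c ^ 2 * s := by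
    rcases le_or_gt ‖u‖ ‖w‖ with hle | hlt
    · have hw : w ≠ 0 := by
        rintro rfl
        simp only [norm_zero, norm_le_zero_iff] at hle
        simp [hle] at huw
      have ht : ‖u / w‖ ≤ 1 := by
        rw [norm_div]
        exact div_le_one_of_le₀ hle (norm_nonneg _)
      obtain ⟨t, ht⟩ : ∃ t : ℤ_[p], (t : ℚ_[p]) = u / w := ⟨⟨u / w, ht⟩, rfl⟩
      refine ⟨w, ((t ^ 2 - t - 3 : ℤ_[p]) : ℚ_[p]), hw, ?_, ?_⟩
      · rw [← PadicInt.norm_def, ← PadicInt.isUnit_iff]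
        by_contra hu
        rw [← mem_nonunits_iff, ← IsLocalRing.mem_maximalIdeal, ← PadicInt.ker_toZMod,
          RingHom.mem_ker] at hu
        exact hirr (PadicInt.toZMod t) (by simpa [map_ofNat PadicInt.toZMod 3] using hu)
      · push_cast
        rw [ht, h3]
        field_simp
    · have hu : u ≠ 0 := by
        rintro rfl
        simp only [norm_zero] at hlt
        exact absurd hlt (not_lt.2 (norm_nonneg _))
      have ht : ‖w / u‖ < 1 := by
        rw [norm_div]
        exact (div_lt_one (norm_pos_iff.2 hu)).2 hlt
      obtain ⟨t, ht'⟩ : ∃ t : ℤ_[p], (t : ℚ_[p]) = w / u := ⟨⟨w / u, ht.le⟩, rfl⟩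
      refine ⟨u, ((1 - t - 3 * t ^ 2 : ℤ_[p]) : ℚ_[p]), hu, ?_, ?_⟩
      · rw [← ht', ← PadicInt.norm_def] at ht
        rw [← PadicInt.norm_def, ← PadicInt.isUnit_iff]
        have ht0 : PadicInt.toZMod t = 0 := by
          rw [← RingHom.mem_ker, PadicInt.ker_toZMod, IsLocalRing.mem_maximalIdeal,
            PadicInt.mem_nonunits]
          exact ht
        by_contra hu
        rw [← mem_nonunits_iff, ← IsLocalRing.mem_maximalIdeal, ← PadicInt.ker_toZMod,
          RingHom.mem_ker] at hu
        simp [ht0] at hu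
      · push_cast
        rw [ht', h3]
        field_simp
  obtain ⟨c, s, hc, hs, e⟩ := key
  have hs0 : s ≠ 0 := by
    rintro rfl
    simp at hs
  have hsv : s.valuation = 0 := by
    have h1 := Padic.norm_eq_zpow_neg_valuation hs0
    rw [hs, eq_comm, zpow_eq_one_iff_right₀ (by positivity)
      (by exact_mod_cast hp.out.ne_one)] at h1
    omega
  rw [e]
  refine ⟨mul_ne_zero (pow_ne_zero 2 hc) hs0, ?_⟩
  rw [Padic.valuation_mul (pow_ne_zero 2 hc) hs0, Padic.valuation_pow, hsv, add_zero]
  exact even_two.mul_right _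

theorem not_hasPoint_of_anisotropic (hirr : ∀ t : ZMod p, t ^ 2 - t - 3 ≠ 0) {d : ℤ}
    (hd : Squarefree d) (hpd : (p : ℤ) ∣ d) : ¬ HasPoint d ℚ_[p] := by
  rintro ⟨x, y, z, hxz, e⟩
  have hxz' : x + 2 * z ≠ 0 ∨ 2 * z ≠ 0 := by
    by_contra! hc
    obtain ⟨h1, h2⟩ := hc
    have hz : z = 0 := by simpa using h2
    rw [h2, add_zero] at h1
    simp [h1, hz] at hxz
  obtain ⟨h1, e1⟩ := even_valuation_normForm hirr x z hxz
  obtain ⟨h2, e2⟩ := even_valuation_normForm hirr (x + 2 * z) (2 * z) hxz'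
  have e' : (d : ℚ_[p]) * y ^ 2 = (x ^ 2 - x * z - 3 * z ^ 2) *
      ((x + 2 * z) ^ 2 - (x + 2 * z) * (2 * z) - 3 * (2 * z) ^ 2) := by
    rw [e, form]; ring
  have hne := mul_ne_zero h1 h2
  have hd0 : (d : ℚ_[p]) ≠ 0 := by exact_mod_cast hd.ne_zero
  have hy0 : y ^ 2 ≠ 0 := by
    intro h0
    rw [← e', h0, mul_zero] at hne
    exact hne rfl
  have hv := congrArg Padic.valuation e'
  rw [Padic.valuation_mul hd0 hy0, Padic.valuation_mul h1 h2, Padic.valuation_pow,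
    Padic.valuation_intCast] at hv
  have hvd : padicValInt p d = 1 := by
    obtain ⟨m, rfl⟩ := hpd
    have hm0 : m ≠ 0 := right_ne_zero_of_mul hd.ne_zero
    have hpm : ¬ (p : ℤ) ∣ m := fun hpm =>
      (Nat.prime_iff_prime_int.1 hp.out).not_isUnit (hd p (mul_dvd_mul_left _ hpm))
    rw [padicValInt.mul (by exact_mod_cast hp.out.ne_zero) hm0, padicValInt.self hp.out.one_lt,
      padicValInt.eq_zero_of_not_dvd hpm]
  rw [hvd] at hv
  have := e1.add e2
  rw [← hv] at this
  obtain ⟨k, hk⟩ := this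
  push_cast at hk
  omega

end Padic

/-! ### Inert primes and residues modulo 13. -/

theorem anisotropic_two : ∀ t : ZMod 2, t ^ 2 - t - 3 ≠ 0 := by decide

/-- The norm form is anisotropic modulo the primes that are inert in `ℚ(√13)`. -/
theorem anisotropic_of_legendreSym_ne_one {p : ℕ} [hp : Fact p.Prime] (hp13 : p ≠ 13)
    (h : legendreSym 13 (p : ℤ) ≠ 1) (t : ZMod p) : t ^ 2 - t - 3 ≠ 0 := by
  by_cases hp2 : p = 2
  · subst hp2
    exact anisotropic_two t
  · intro ht
    have hsq : IsSquare ((13 : ℕ) : ZMod p) :=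
      ⟨2 * t - 1, by push_cast; linear_combination -4 * ht⟩
    have hp0 : ((p : ℕ) : ZMod 13) ≠ 0 := by
      rw [Ne, ZMod.natCast_eq_zero_iff]
      exact fun hd => hp13 ((Nat.prime_dvd_prime_iff_eq (by norm_num) hp.out).1 hd).symm
    rw [← ZMod.exists_sq_eq_prime_iff_of_mod_four_eq_one (p := 13) (by norm_num) hp2] at hsq
    exact h ((legendreSym.eq_one_iff' 13 hp0).2 hsq)

theorem legendreSym_natCast_eq_one {q : ℕ} [Fact q.Prime] (n : ℕ) (hn : n ≠ 0)
    (h : ∀ p : ℕ, p.Prime → p ∣ n → legendreSym q (p : ℤ) = 1) :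
    legendreSym q (n : ℤ) = 1 := by
  induction n using induction_on_primes with
  | zero => exact absurd rfl hn
  | one => simp
  | prime_mul p a hp ih =>
    rw [Nat.cast_mul, legendreSym.mul, h p hp (dvd_mul_right _ _),
      ih (right_ne_zero_of_mul hn) fun r hr hra => h r hr (hra.mul_left p), one_mul]

theorem legendreSym_intCast_eq_one {q : ℕ} [Fact q.Prime] (hq : legendreSym q (-1) = 1) (n : ℤ)
    (hn : n ≠ 0) (h : ∀ p : ℕ, p.Prime → (p : ℤ) ∣ n → legendreSym q (p : ℤ) = 1) :
    legendreSym q n = 1 := by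
  have h1 := legendreSym_natCast_eq_one (q := q) n.natAbs (Int.natAbs_ne_zero.2 hn)
    fun p hp hpn => h p hp (Int.natCast_dvd.2 hpn)
  rcases Int.natAbs_eq n with h2 | h2
  · rwa [h2]
  · rw [h2, neg_eq_neg_one_mul, legendreSym.mul, hq, h1, one_mul]

/-! ### Local points, prime by prime. -/

theorem hasPoint_two_adic {d : ℤ} (h : ¬ (2 : ℤ) ∣ d) : HasPoint d ℚ_[2] := by
  have hd : (d : ℚ_[2]) ≠ 0 := by
    have : d ≠ 0 := by rintro rfl; simp at h
    exact_mod_cast this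
  have hmod : d % 8 = 1 ∨ d % 8 = 3 ∨ d % 8 = 5 ∨ d % 8 = 7 := by omega
  -- The values 1, 27, 13, -36 lie in the square classes of 1, 3, 5, 7 in `ℚ_2`, so one of them
  -- matches each odd `d`.
  rcases hmod with h | h | h | h
  · exact hasPoint_of_isSquare hd (two_adic_isSquare_of_mod_eight d h)
  · refine hasPoint_of_isSquare_mul hd 1 1 (Or.inr one_ne_zero) ?_
    have := two_adic_isSquare_of_mod_eight (d * 27) (by omega)
    have e : (d : ℚ_[2]) * form 1 1 = ((d * 27 : ℤ) : ℚ_[2]) := by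
      simp only [form]; push_cast; ring
    rwa [e]
  · exact hasPoint_of_isSquare_mul_thirteen hd (two_adic_isSquare_of_mod_eight _ (by omega))
  · refine hasPoint_of_isSquare_mul hd (-2) 1 (Or.inr one_ne_zero) ?_
    have := (two_adic_isSquare_of_mod_eight (-d) (by omega)).mul (IsSquare.sq (6 : ℚ_[2]))
    have e : (d : ℚ_[2]) * form (-2) 1 = ((-d : ℤ) : ℚ_[2]) * 6 ^ 2 := by
      simp only [form]; push_cast; ring
    rwa [e]

theorem hasPoint_thirteen_adic {d : ℤ} (hd : Squarefree d)
    (h : ∀ p : ℕ, p.Prime → (p : ℤ) ∣ d → legendreSym 13 (p : ℤ) = 1 ∨ p = 13) :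
    HasPoint d ℚ_[13] := by
  have hd0 : (d : ℚ_[13]) ≠ 0 := by exact_mod_cast hd.ne_zero
  -- Up to sign, `m` is a product of residues modulo 13, and `-1 = 5²` there.
  have square : ∀ m : ℤ, m ∣ d → ¬ (13 : ℤ) ∣ m → IsSquare (m : ℚ_[13]) := by
    intro m hmd hm
    have hm13 : ((m : ℤ) : ZMod 13) ≠ 0 := by
      rw [Ne, ZMod.intCast_zmod_eq_zero_iff_dvd]
      exact_mod_cast hm
    refine padic_isSquare_of_isSquare_zmod (by norm_num) m hm13
      ((legendreSym.eq_one_iff 13 hm13).1 ?_)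
    have hneg : legendreSym 13 (-1) = 1 :=
      (legendreSym.eq_one_iff 13 (by decide)).2 ⟨5, by decide⟩
    refine legendreSym_intCast_eq_one hneg m ?_ fun p hp hpm => ?_
    · rintro rfl
      simp at hm
    · refine (h p hp (hpm.trans hmd)).resolve_right ?_
      rintro rfl
      exact hm (by exact_mod_cast hpm)
  by_cases h13 : (13 : ℤ) ∣ d
  · obtain ⟨m, rfl⟩ := h13
    have hm : ¬ (13 : ℤ) ∣ m := fun hm => by
      have := hd 13 (mul_dvd_mul_left _ hm)
      rw [Int.isUnit_iff] at this
      omega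
    refine hasPoint_of_isSquare_mul_thirteen hd0 ?_
    have := (square m (dvd_mul_left _ _) hm).mul (IsSquare.sq (13 : ℚ_[13]))
    have e : ((13 * m * 13 : ℤ) : ℚ_[13]) = (m : ℚ_[13]) * 13 ^ 2 := by
      push_cast; ring
    rwa [e]
  · exact hasPoint_of_isSquare hd0 (square d dvd_rfl h13)

theorem hasPoint_padic_of_ne {p : ℕ} [hp : Fact p.Prime] (hp2 : p ≠ 2) (hp13 : p ≠ 13) {d : ℤ}
    (hd : d ≠ 0) (h : (p : ℤ) ∣ d → legendreSym 13 (p : ℤ) = 1) : HasPoint d ℚ_[p] := by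
  have hd0 : (d : ℚ_[p]) ≠ 0 := by exact_mod_cast hd
  have h13 : ((13 : ℤ) : ZMod p) ≠ 0 := by
    rw [Ne, ZMod.intCast_zmod_eq_zero_iff_dvd]
    intro hdvd
    have hdvd : p ∣ 13 := by exact_mod_cast hdvd
    exact hp13 ((Nat.prime_dvd_prime_iff_eq hp.out (by norm_num)).1 hdvd)
  by_cases hs : IsSquare ((13 : ℤ) : ZMod p)
  · exact hasPoint_of_isSquare_thirteen (padic_isSquare_of_isSquare_zmod hp2 13 h13 hs)
  have hpd : (d : ZMod p) ≠ 0 := by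
    rw [Ne, ZMod.intCast_zmod_eq_zero_iff_dvd]
    intro hdvd
    have hp0 : ((p : ℕ) : ZMod 13) ≠ 0 := by
      rw [Ne, ZMod.natCast_eq_zero_iff]
      exact fun hd => hp13 ((Nat.prime_dvd_prime_iff_eq (by norm_num) hp.out).1 hd).symm
    have h1 := (legendreSym.eq_one_iff' 13 hp0).1 (h hdvd)
    rw [ZMod.exists_sq_eq_prime_iff_of_mod_four_eq_one (p := 13) (by norm_num) hp2] at h1
    exact hs (by exact_mod_cast h1)
  -- Now `d` and 13 are units modulo `p` and 13 is a nonresidue, so `d` or `13d` is a residue.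
  by_cases hds : IsSquare (d : ZMod p)
  · exact hasPoint_of_isSquare hd0 (padic_isSquare_of_isSquare_zmod hp2 d hpd hds)
  · have hne : ((d * 13 : ℤ) : ZMod p) ≠ 0 := by
      rw [Int.cast_mul]
      exact mul_ne_zero hpd h13
    refine hasPoint_of_isSquare_mul_thirteen hd0
      (padic_isSquare_of_isSquare_zmod hp2 _ hne ((legendreSym.eq_one_iff p hne).1 ?_))
    rw [legendreSym.mul, (legendreSym.eq_neg_one_iff p).2 hs, (legendreSym.eq_neg_one_iff p).2 hds]
    norm_num

end TwistedQuartic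

open TwistedQuartic

theorem proposition2p1 (d : ℤ) (hd : Squarefree d) :
    TwistedQuartic.EverywhereLocallySolvable d ↔
      ∀ p : ℕ, p.Prime → (p : ℤ) ∣ d → legendreSym 13 (p : ℤ) = 1 ∨ p = 13 := by
  constructor
  · rintro ⟨-, hloc⟩ p hp hpd
    by_contra! hc
    have : Fact p.Prime := ⟨hp⟩
    exact not_hasPoint_of_anisotropic (anisotropic_of_legendreSym_ne_one hc.2 hc.1) hd hpd (hloc p)
  · intro h
    refine ⟨hasPoint_real hd.ne_zero, fun p hp => ?_⟩
    by_cases hp13 : p = 13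
    · subst hp13
      exact hasPoint_thirteen_adic hd h
    by_cases hp2 : p = 2
    · subst hp2
      refine hasPoint_two_adic fun h2 => ?_
      have h3 := (h 2 Nat.prime_two (by exact_mod_cast h2)).resolve_right hp13
      rw [legendreSym.eq_one_iff 13 (by decide)] at h3
      revert h3
      decide
    · exact hasPoint_padic_of_ne hp2 hp13 hd.ne_zero
        fun hpd => (h p hp.out hpd).resolve_right hp13
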